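/- Let $\mathbb F=\mathbb F_q$ be a finite field, let $r_1,r_2$ be positive integers with $\gcd(q,r_1r_2)=1$, let $\mathbb L\supseteq\mathbb F$ be an extension field, and let $\alpha_1,\alpha_2\in\mathbb L$ be primitive $r_1$-th and $r_2$-th roots of unity. Put $\mathcal I=\{0,\dots,r_1-1\}\times\{0,\dots,r_2-1\}$. Let $2\le t\le 4$ with $t\le\lfloor r_i/2\rfloor$ for $i=1,2$, let $\tau\in\mathcal I$, and let $e=\sum_{m\in\mathcal I}e_mX_1^{m_1}X_2^{m_2}\in\mathbb F[X_1,X_2]$ have at most $t$ nonzero coefficients. Let $U=(u_n)_{n\in\mathbb N^2}$, $\mathbb N=\{0,1,2,\dots\}$, be the syndrome table afforded by $\tau$ and $e$, that is, $u_n=e(\alpha_1^{\tau_1+n_1},\alpha_2^{\tau_2+n_2})$. Let $\preceq$ be the componentwise order on $\mathbb N^2$ and let $\le_T$ be either the lexicographic order with $X_1>X_2$ or the graded order with $X_2>X_1$ (total degrees are compared first, ties are broken by the exponent of $X_2$). For a nonzero $f=\sum_m f_m\mathbf X^m\in\mathbb L[X_1,X_2]$ let $LP(f)$ be the exponent of its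 $\le_T$-leading monomial, and for $n\in\mathbb N^2$ put $$f[U]_n=\begin{cases}\sum_m f_m\,u_{m+n-LP(f)}&\text{if }LP(f)\preceq n,\\ 0&\text{otherwise.}\end{cases}$$ Let $$\mathcal B(2t+1)=\{n\in\mathcal I : (n_1+1)(n_2+1)\le 2t+1\}\setminus\{(2t,0),(0,2t)\},$$ and let $K$ be any set with $\mathcal B(2t+1)\subseteq K\subseteq\mathbb N^2$ (the region of indices over which the array is processed; for example $K=\mathcal B(2t+1)$, $K=\mathcal I$ or $K=\mathbb N^2$). For $l\in\mathbb N^2$ let $\Lambda(u^l)$ be the set of all $f$ such that $f[U]_k=0$ for every $k\in K$ with $LP(f)\preceq k$ and $k<_Tl$. A finite list $F_l=\{f^{(1)},\dots,f^{(d)}\}$, $d\ge1$, of nonzero elements of $\Lambda(u^l)$ with $s^{(i)}=LP(f^{(i)})$ is called a minimal set of polynomials for $u^l$ if $$s^{(1)}_1>\dots>s^{(d)}_1=0,\qquad 0=s^{(1)}_2<\dots<s^{(d)}_2,$$ and no nonzero $g\in\Lambda(u^l)$ has $LP(g)$ in the footprint $$\Delta(u^l)=\{n : n\preceq(s^{(i)}_1-1,\,s^{(i+1)}_2-1)\text{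 for some }1\le i\le d-1\}.$$ Such minimal sets are what the Berlekamp–Massey–Sakata algorithm maintains. **Theorem.** Let $l=(2t-1,0)$ or $l=(0,2t-1)$, and let $F_l=\{f^{(1)},\dots,f^{(d)}\}$ be any minimal set of polynomials for $u^l$. Then there is an $f\in F_l$ with $LP(f)\preceq l$ and $f[U]_l=0$, except possibly in the following cases: 1. $l=(0,2t-1)$, $d\ge2$ and $s^{(2)}_2=t$; 2. $l=(2t-1,0)$ and $s^{(1)}_1=t$. In both of these cases $d=2$. -/

import Mathlib

namespace BMS

/-- Index pairs `(n₁, n₂) ∈ ℕ × ℕ`, i.e. exponents of monomials in two variables: `n₁ = n 0` and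
`n₂ = n 1`.  The partial order `≤` on this type is the componentwise one, `⪯`. -/
abbrev Idx : Type := Fin 2 →₀ ℕ

/-- The graded order with `X₂ > X₁`: compare total degrees and break ties by the second exponent
(see `graded_lt_iff`).  The lexicographic order with `X₁ > X₂` is Mathlib's `MonomialOrder.lex`
(see `lex_lt_iff`). -/
noncomputable def gradedOrder : MonomialOrder (Fin 2) where
  syn := (MonomialOrder.degLex (σ := Fin 2)).syn
  toSyn := (Finsupp.domCongr (Equiv.swap (0 : Fin 2) 1)).trans
    (MonomialOrder.degLex (σ := Fin 2)).toSyn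
  toSyn_monotone := by
    intro a b h
    apply (MonomialOrder.degLex (σ := Fin 2)).toSyn_monotone
    change Finsupp.equivMapDomain (Equiv.swap (0 : Fin 2) 1) a ≤
      Finsupp.equivMapDomain (Equiv.swap (0 : Fin 2) 1) b
    intro i
    simpa only [Finsupp.equivMapDomain_apply] using h _

theorem lex_lt_iff (n m : Idx) :
    (MonomialOrder.lex (σ := Fin 2)).toSyn n < (MonomialOrder.lex (σ := Fin 2)).toSyn m ↔
      n 0 < m 0 ∨ (n 0 = m 0 ∧ n 1 < m 1) := by
  rw [MonomialOrder.lex_lt_iff, Finsupp.Lex.lt_iff]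
  simp [Fin.exists_fin_two, Fin.forall_fin_two]

theorem graded_lt_iff (n m : Idx) :
    gradedOrder.toSyn n < gradedOrder.toSyn m ↔
      n 0 + n 1 < m 0 + m 1 ∨ (n 0 + n 1 = m 0 + m 1 ∧ n 1 < m 1) := by
  change (MonomialOrder.degLex (σ := Fin 2)).toSyn
      (Finsupp.domCongr (Equiv.swap (0 : Fin 2) 1) n) <
    (MonomialOrder.degLex (σ := Fin 2)).toSyn
      (Finsupp.domCongr (Equiv.swap (0 : Fin 2) 1) m) ↔ _
  rw [MonomialOrder.degLex_lt_iff, Finsupp.DegLex.lt_iff, Finsupp.Lex.lt_iff]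
  simp [Fin.exists_fin_two, Fin.forall_fin_two, Finsupp.degree_eq_sum, Fin.sum_univ_two]
  omega

/-- The index set `ℤ_{r₁} × ℤ_{r₂}`, through canonical representatives. -/
def indexSet (r : Fin 2 → ℕ) : Set Idx := {n | ∀ i, n i < r i}

/-- The hyperbolic set `𝓑(δ)` of amplitude `δ`. -/
def hyperbolicSet (r : Fin 2 → ℕ) (δ : ℕ) : Set Idx :=
  {n | n ∈ indexSet r ∧ (n 0 + 1) * (n 1 + 1) ≤ δ} \
    {Finsupp.single 0 (δ - 1), Finsupp.single 1 (δ - 1)}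

/-- The border indexes `𝔉` of `𝓑(2t+1)`. -/
def borderSet (r : Fin 2 → ℕ) (t : ℕ) : Set Idx :=
  {n | n ∈ hyperbolicSet r (2 * t + 1) ∧ 2 * t ≤ (n 0 + 1) * (n 1 + 1)}

/-- The syndrome table afforded by `τ` and `e`: `u_n = e(α^(τ+n))`. -/
noncomputable def syndromeTable {F L : Type*} [Field F] [Field L] [Algebra F L]
    (α : Fin 2 → L) (τ : Idx) (e : MvPolynomial (Fin 2) F) : Idx → L :=
  fun n => MvPolynomial.aeval (fun i => α i ^ (τ i + n i)) e

section

variable {L : Type*} [Field L]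

open Classical in
/-- `f[U]_n`: the value at `n` of the linear recurrence given by `f`, where `T` is the monomial
order and `T.degree f` is the leading power product exponent `LP(f)`. -/
noncomputable def recVal (T : MonomialOrder (Fin 2)) (U : Idx → L)
    (f : MvPolynomial (Fin 2) L) (n : Idx) : L :=
  if T.degree f ≤ n then ∑ m ∈ f.support, f.coeff m * U (m + n - T.degree f) else 0

/-- `f[u^l] = 0`: the recurrence given by `f` holds at all indices `k <_T l` with `LP(f) ⪯ k`
in the region `K` of indices over which the array is processed. -/
def Generates (T : MonomialOrder (Fin 2)) (K : Set Idx) (U : Idx → L) (l : Idx)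
    (f : MvPolynomial (Fin 2) L) : Prop :=
  ∀ k ∈ K, T.degree f ≤ k → T.toSyn k < T.toSyn l → recVal T U f k = 0

/-- The footprint of a list `f⁽¹⁾, …, f⁽ᵈ⁾` with `s⁽ⁱ⁾ = LP(f⁽ⁱ⁾)`: all `n` such that
`n ⪯ (s⁽ⁱ⁾₁ - 1, s⁽ⁱ⁺¹⁾₂ - 1)` for some `1 ≤ i ≤ d - 1`.  (The list is `F 0, …, F (d - 1)`.) -/
def footprint (T : MonomialOrder (Fin 2)) {d : ℕ} (F : Fin d → MvPolynomial (Fin 2) L) :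
    Set Idx :=
  {n | ∃ i j : Fin d, (j : ℕ) = (i : ℕ) + 1 ∧
    n 0 < T.degree (F i) 0 ∧ n 1 < T.degree (F j) 1}

/-- `F = {f⁽¹⁾, …, f⁽ᵈ⁾}` is a minimal set of polynomials for `u^l`. -/
structure IsMinimalSet (T : MonomialOrder (Fin 2)) (K : Set Idx) (U : Idx → L) (l : Idx)
    {d : ℕ} (F : Fin d → MvPolynomial (Fin 2) L) : Prop where
  pos : 0 < d
  ne_zero : ∀ i, F i ≠ 0
  generates : ∀ i, Generates T K U l (F i)
  strictAnti_fst : StrictAnti fun i => T.degree (F i) 0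
  strictMono_snd : StrictMono fun i => T.degree (F i) 1
  first_snd : T.degree (F ⟨0, pos⟩) 1 = 0
  last_fst : T.degree (F ⟨d - 1, Nat.sub_lt pos one_pos⟩) 0 = 0
  minimal : ∀ g : MvPolynomial (Fin 2) L, g ≠ 0 → T.degree g ∈ footprint T F →
    ¬ Generates T K U l g

end

/-- The exceptional configurations: `l = (0, 2t-1)` and `s⁽²⁾₂ = t`, or `l = (2t-1, 0)` and
`s⁽¹⁾₁ = t`.  (The polynomial `f⁽ⁱ⁾` is `F (i - 1)`; the first case contains `d ≥ 2`.) -/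
def Exceptional {L : Type*} [Field L] (T : MonomialOrder (Fin 2)) (t : ℕ) (l : Idx) {d : ℕ}
    (F : Fin d → MvPolynomial (Fin 2) L) : Prop :=
  (l = Finsupp.single 1 (2 * t - 1) ∧ ∃ i : Fin d, (i : ℕ) = 1 ∧ T.degree (F i) 1 = t) ∨
  (l = Finsupp.single 0 (2 * t - 1) ∧ ∃ i : Fin d, (i : ℕ) = 0 ∧ T.degree (F i) 0 = t)

end BMS

namespace BMS

/-! The table is a combination of at most `t` exponentials, one for each point `P j`, and `f` acts
on the `j`-th of them as the scalar `f (P j)` (`recVal_eq_sum`). If `LP(f)` is `s` on an axis, the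
values of the recurrence along that axis form a one-variable sum of at most `t` exponentials. When
`s < t`, its known zeros at `s, …, 2t - 2` are at least `t` in number and force a zero at `2t - 1`.

It remains to bound `s` for the generator on the axis. A set of footprint exponents larger than the
number of points would support a polynomial vanishing at all of them, against minimality; so `s ≤
t`. For `d > 2` the footprint also contains the unit exponent of the other axis, so `s < t`. Hence
`s = t` only when `d = 2`, which is the exceptional case. -/

/-- A combination of `w` exponentials that vanishes at the exponents `0, …, w - 1` vanishes
identically. -/
theorem sum_mul_pow_eq_zero {ι L : Type*} [Field L] (S : Finset ι) (a x : ι → L)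
    (h : ∀ i < S.card, ∑ j ∈ S, a j * x j ^ i = 0) (n : ℕ) : ∑ j ∈ S, a j * x j ^ n = 0 := by
  classical
  -- Modulo `p`, which vanishes at every node, `X ^ n` becomes a combination of `1, …, X ^ (w - 1)`.
  -- The nodes need not be distinct.
  set p : Polynomial L := ∏ j ∈ S, (Polynomial.X - Polynomial.C (x j)) with hp
  have hmon : p.Monic := Polynomial.monic_prod_of_monic _ _ fun j _ => Polynomial.monic_X_sub_C _
  have hdeg : p.degree = S.card := by
    rw [hp, Polynomial.degree_prod]
    simp
  set q := (Polynomial.X ^ n : Polynomial L) %ₘ p with hq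
  have hqdeg : q.degree < S.card := hdeg ▸ Polynomial.degree_modByMonic_lt _ hmon
  have heval : ∀ j ∈ S, x j ^ n = q.eval (x j) := by
    intro j hj
    have hroot : p.eval (x j) = 0 := by
      rw [hp, Polynomial.eval_prod]
      exact Finset.prod_eq_zero hj (by simp)
    have := congrArg (Polynomial.eval (x j)) (Polynomial.modByMonic_add_div (Polynomial.X ^ n) p)
    rw [Polynomial.eval_add, Polynomial.eval_mul, hroot, zero_mul, add_zero] at this
    simpa using this.symm
  have hsum : ∀ y, q.eval y = ∑ i ∈ Finset.range S.card, q.coeff i * y ^ i := by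
    intro y
    rcases eq_or_ne q 0 with h0 | h0
    · simp [h0]
    · exact Polynomial.eval_eq_sum_range' ((Polynomial.natDegree_lt_iff_degree_lt h0).2 hqdeg) y
  calc ∑ j ∈ S, a j * x j ^ n
      = ∑ j ∈ S, ∑ i ∈ Finset.range S.card, q.coeff i * (a j * x j ^ i) := by
        refine Finset.sum_congr rfl fun j hj => ?_
        rw [heval j hj, hsum, Finset.mul_sum]
        exact Finset.sum_congr rfl fun i _ => by ring
    _ = ∑ i ∈ Finset.range S.card, q.coeff i * ∑ j ∈ S, a j * x j ^ i := by
        rw [Finset.sum_comm]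
        simp_rw [Finset.mul_sum]
    _ = 0 := Finset.sum_eq_zero fun i hi => by rw [h i (Finset.mem_range.1 hi), mul_zero]

/-- The syndrome table is a combination of exponentials, one for each nonzero coefficient. -/
theorem syndromeTable_eq_sum {F L : Type*} [Field F] [Field L] [Algebra F L]
    (α : Fin 2 → L) (τ : Idx) (e : MvPolynomial (Fin 2) F) (n : Idx) :
    syndromeTable α τ e n = ∑ m ∈ e.support,
      (algebraMap F L (e.coeff m) * ∏ i, α i ^ (τ i * m i)) * ∏ i, (α i ^ m i) ^ n i := by
  rw [syndromeTable, MvPolynomial.aeval_def, MvPolynomial.eval₂_eq']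
  refine Finset.sum_congr rfl fun m _ => ?_
  rw [mul_assoc, ← Finset.prod_mul_distrib]
  congr 1
  refine Finset.prod_congr rfl fun i _ => ?_
  rw [← pow_mul, ← pow_mul, ← pow_add]
  congr 1
  ring

section

variable {ι L : Type*} [Field L] {S : Finset ι} {c : ι → L} {P : ι → Fin 2 → L} {U : Idx → L}

/-- Exponentials are eigenvectors of shifts, so each is scaled by the value of `f` at its point. -/
theorem recVal_eq_sum (hU : ∀ n, U n = ∑ j ∈ S, c j * ∏ i, P j i ^ n i)
    {T : MonomialOrder (Fin 2)} {f : MvPolynomial (Fin 2) L} {n : Idx} (hn : T.degree f ≤ n) :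
    recVal T U f n =
      ∑ j ∈ S, c j * MvPolynomial.eval (P j) f * ∏ i, P j i ^ (n i - T.degree f i) := by
  rw [recVal, if_pos hn]
  simp_rw [hU, Finset.mul_sum]
  rw [Finset.sum_comm]
  refine Finset.sum_congr rfl fun j _ => ?_
  rw [MvPolynomial.eval_eq', Finset.mul_sum, Finset.sum_mul]
  refine Finset.sum_congr rfl fun m _ => ?_
  have : ∏ i, P j i ^ (m + n - T.degree f) i =
      (∏ i, P j i ^ m i) * ∏ i, P j i ^ (n i - T.degree f i) := by
    rw [← Finset.prod_mul_distrib]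
    refine Finset.prod_congr rfl fun i _ => ?_
    rw [← pow_add]
    congr 1
    have := hn i
    simp only [Finsupp.coe_tsub, Finsupp.coe_add, Pi.sub_apply, Pi.add_apply]
    omega
  rw [this]
  ring

theorem generates_of_eval_eq_zero (hU : ∀ n, U n = ∑ j ∈ S, c j * ∏ i, P j i ^ n i)
    {T : MonomialOrder (Fin 2)} {K : Set Idx} {l : Idx} {f : MvPolynomial (Fin 2) L}
    (hf : ∀ j ∈ S, MvPolynomial.eval (P j) f = 0) : Generates T K U l f := by
  intro k _ hk _
  rw [recVal_eq_sum hU hk]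
  exact Finset.sum_eq_zero fun j hj => by rw [hf j hj]; simp

/-- More monomials than points admit a nontrivial combination vanishing at all the points. -/
theorem exists_ne_zero_support_subset_eval_eq_zero (P : ι → Fin 2 → L) (M : Finset Idx)
    (hM : S.card < M.card) :
    ∃ g : MvPolynomial (Fin 2) L, g ≠ 0 ∧ g.support ⊆ M ∧
      ∀ j ∈ S, MvPolynomial.eval (P j) g = 0 := by
  classical
  -- A kernel vector of the evaluation matrix gives the coefficients; there are more columns than
  -- rows.
  let A : Matrix S M L := Matrix.of fun j m => ∏ i, P j i ^ (m : Idx) i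
  have hker : LinearMap.ker A.mulVecLin ≠ ⊥ := by
    apply LinearMap.ker_ne_bot_of_finrank_lt
    simpa using hM
  obtain ⟨v, hv, hv0⟩ := (Submodule.ne_bot_iff _).1 hker
  let g : MvPolynomial (Fin 2) L := ∑ m : M, MvPolynomial.monomial (m : Idx) (v m)
  have hcoeff : ∀ m : M, g.coeff (m : Idx) = v m := by
    intro m
    simp only [g, MvPolynomial.coeff_sum, MvPolynomial.coeff_monomial, Subtype.coe_inj]
    simp
  refine ⟨g, fun h0 => hv0 (funext fun m => ?_), fun m hm => ?_, fun j hj => ?_⟩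
  · rw [← hcoeff m, h0]
    simp
  · by_contra hmM
    refine MvPolynomial.mem_support_iff.1 hm ?_
    simp only [g, MvPolynomial.coeff_sum, MvPolynomial.coeff_monomial]
    refine Finset.sum_eq_zero fun m' _ => if_neg ?_
    rintro rfl
    exact hmM m'.2
  · have := congrFun (LinearMap.mem_ker.1 hv) ⟨j, hj⟩
    simp only [Matrix.mulVecLin_apply, Matrix.mulVec, dotProduct, A, Matrix.of_apply,
      Pi.zero_apply] at this
    rw [← this]
    simp only [g, map_sum, MvPolynomial.eval_monomial]
    refine Finset.sum_congr rfl fun m _ => ?_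
    rw [Finsupp.prod_fintype _ _ (by simp), mul_comm]

variable {T : MonomialOrder (Fin 2)} {K : Set Idx} {l : Idx} {d : ℕ}
  {F : Fin d → MvPolynomial (Fin 2) L}

/-- The footprint of a minimal set has at most as many elements as there are points. -/
theorem IsMinimalSet.card_le (hF : IsMinimalSet T K U l F)
    (hU : ∀ n, U n = ∑ j ∈ S, c j * ∏ i, P j i ^ n i) (M : Finset Idx)
    (hM : (M : Set Idx) ⊆ footprint T F) : M.card ≤ S.card := by
  by_contra! h
  obtain ⟨g, hg0, hgM, hg⟩ := exists_ne_zero_support_subset_eval_eq_zero P M h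
  exact hF.minimal g hg0 (hM (hgM (T.degree_mem_support hg0))) (generates_of_eval_eq_zero hU hg)

/-- The exponents `0, …, s - 1` on the axis `a`. -/
noncomputable def axis (a : Fin 2) (s : ℕ) : Finset Idx :=
  (Finset.range s).map ⟨Finsupp.single a, Finsupp.single_injective a⟩

theorem card_axis (a : Fin 2) (s : ℕ) : (axis a s).card = s := by
  rw [axis, Finset.card_map, Finset.card_range]

theorem mem_axis {a : Fin 2} {s : ℕ} {n : Idx} :
    n ∈ axis a s ↔ ∃ i < s, Finsupp.single a i = n := by
  simp [axis]

/-- If the footprint contains `s` exponents of one axis and the unit exponent of the other axis,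
then there are more than `s` points. -/
theorem IsMinimalSet.card_axis_le (hF : IsMinimalSet T K U l F)
    (hU : ∀ n, U n = ∑ j ∈ S, c j * ∏ i, P j i ^ n i) {a b : Fin 2} (hab : a ≠ b) {s : ℕ}
    (h1 : (axis a s : Set Idx) ⊆ footprint T F)
    (h2 : Finsupp.single b 1 ∈ footprint T F) : s + 1 ≤ S.card := by
  classical
  have hnot : (Finsupp.single b 1 : Idx) ∉ axis a s := by
    rw [mem_axis]
    rintro ⟨i, -, hi⟩
    have := DFunLike.congr_fun hi b
    rw [Finsupp.single_eq_of_ne hab.symm, Finsupp.single_eq_same] at this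
    omega
  have := hF.card_le hU (insert (Finsupp.single b 1) (axis a s)) (by
    rw [Finset.coe_insert]
    exact Set.insert_subset h2 h1)
  rwa [Finset.card_insert_of_notMem hnot, card_axis] at this

/-- A nonempty axis segment forces `d ≥ 2`, and then the first step of the staircase covers it. -/
theorem IsMinimalSet.axis_fst_subset (hF : IsMinimalSet T K U l F) :
    (axis 0 (T.degree (F ⟨0, hF.pos⟩) 0) : Set Idx) ⊆ footprint T F := by
  intro n hn
  obtain ⟨i, hi, rfl⟩ := mem_axis.1 hn
  have hd : 1 < d := by
    by_contra! hd
    have h1 : d = 1 := le_antisymm hd hF.pos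
    subst h1
    have := hF.last_fst
    simp only [Nat.sub_self] at this
    omega
  have h01 : T.degree (F ⟨0, hF.pos⟩) 1 < T.degree (F ⟨1, hd⟩) 1 :=
    hF.strictMono_snd (Fin.mk_lt_mk.2 zero_lt_one)
  exact ⟨⟨0, hF.pos⟩, ⟨1, hd⟩, rfl, by simpa using hi, by
    rw [Finsupp.single_eq_of_ne one_ne_zero]; omega⟩

theorem IsMinimalSet.axis_snd_subset (hF : IsMinimalSet T K U l F) :
    (axis 1 (T.degree (F ⟨d - 1, Nat.sub_lt hF.pos one_pos⟩) 1) : Set Idx) ⊆ footprint T F := by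
  intro n hn
  obtain ⟨i, hi, rfl⟩ := mem_axis.1 hn
  have hd : 1 < d := by
    by_contra! hd
    have h1 : d = 1 := le_antisymm hd hF.pos
    subst h1
    have := hF.first_snd
    simp only [Nat.sub_self] at hi
    omega
  have hlt : T.degree (F ⟨d - 1, Nat.sub_lt hF.pos one_pos⟩) 0 <
      T.degree (F ⟨d - 2, by omega⟩) 0 :=
    hF.strictAnti_fst (Fin.mk_lt_mk.2 (by omega))
  exact ⟨⟨d - 2, by omega⟩, ⟨d - 1, by omega⟩, by simp only; omega, by
    rw [Finsupp.single_eq_of_ne zero_ne_one]; omega, by simpa using hi⟩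

/-- Strict monotonicity makes both coordinates of the second corner positive: the first step
contains `(1, 0)`, the second `(0, 1)`. -/
theorem IsMinimalSet.single_one_mem (hF : IsMinimalSet T K U l F) (hd : 2 < d) (b : Fin 2) :
    Finsupp.single b 1 ∈ footprint T F := by
  have ha1 : T.degree (F ⟨1, by omega⟩) 0 < T.degree (F ⟨0, by omega⟩) 0 :=
    hF.strictAnti_fst (Fin.mk_lt_mk.2 (by omega))
  have ha2 : T.degree (F ⟨2, hd⟩) 0 < T.degree (F ⟨1, by omega⟩) 0 :=
    hF.strictAnti_fst (Fin.mk_lt_mk.2 (by omega))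
  have hb1 : T.degree (F ⟨0, by omega⟩) 1 < T.degree (F ⟨1, by omega⟩) 1 :=
    hF.strictMono_snd (Fin.mk_lt_mk.2 (by omega))
  have hb2 : T.degree (F ⟨1, by omega⟩) 1 < T.degree (F ⟨2, hd⟩) 1 :=
    hF.strictMono_snd (Fin.mk_lt_mk.2 (by omega))
  fin_cases b
  · exact ⟨⟨0, by omega⟩, ⟨1, by omega⟩, rfl, by simp; omega, by simp; omega⟩
  · exact ⟨⟨1, by omega⟩, ⟨2, hd⟩, rfl, by simp; omega, by simp; omega⟩

/-- A recurrence with leading exponent on an axis and of order less than `t`, valid at the first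
`2t - 1` indices of that axis, is valid at the next index. -/
theorem Generates.recVal_single_eq_zero (hU : ∀ n, U n = ∑ j ∈ S, c j * ∏ i, P j i ^ n i)
    {t : ℕ} (hS : S.card ≤ t) {a : Fin 2} {f : MvPolynomial (Fin 2) L} {s : ℕ}
    (hdeg : T.degree f = Finsupp.single a s) (hst : s < t)
    (hK : ∀ i < 2 * t - 1, Finsupp.single a i ∈ K)
    (hf : Generates T K U (Finsupp.single a (2 * t - 1)) f) :
    T.degree f ≤ Finsupp.single a (2 * t - 1) ∧
      recVal T U f (Finsupp.single a (2 * t - 1)) = 0 := by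
  have hle : ∀ i, T.degree f ≤ Finsupp.single a (s + i) := fun i => by
    rw [hdeg]
    exact Finsupp.single_mono (by omega)
  have hval : ∀ i, recVal T U f (Finsupp.single a (s + i)) =
      ∑ j ∈ S, c j * MvPolynomial.eval (P j) f * P j a ^ i := by
    intro i
    rw [recVal_eq_sum hU (hle i)]
    refine Finset.sum_congr rfl fun j _ => ?_
    rw [hdeg, Finset.prod_eq_single a (fun b _ hb => by simp [Finsupp.single_eq_of_ne hb])
      (by simp)]
    simp
  -- For `i < S.card ≤ t` and `s ≤ t - 1`, the index `s + i` is at most `2t - 2`, hence before `l`.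
  have hzero := sum_mul_pow_eq_zero S (fun j => c j * MvPolynomial.eval (P j) f)
    (fun j => P j a) (fun i hi => by
      rw [← hval]
      refine hf _ (hK _ (by omega)) (hle i) (lt_of_le_of_ne
        (T.toSyn_monotone (Finsupp.single_mono (by omega))) fun h => ?_)
      have := Finsupp.single_injective a (T.toSyn.injective h)
      omega) (2 * t - 1 - s)
  rw [← hval, Nat.add_sub_cancel' (by omega)] at hzero
  refine ⟨?_, hzero⟩
  rw [hdeg]
  exact Finsupp.single_mono (by omega)

end

theorem single_mem_hyperbolicSet {r : Fin 2 → ℕ} {t : ℕ} (htr : ∀ i, t ≤ r i / 2) (a : Fin 2)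
    {i : ℕ} (hi : i < 2 * t) : Finsupp.single a i ∈ hyperbolicSet r (2 * t + 1) := by
  have h0 := htr 0
  have h1 := htr 1
  refine ⟨⟨fun b => ?_, ?_⟩, ?_⟩
  · have := htr b
    rw [Finsupp.single_apply]
    split_ifs <;> omega
  · fin_cases a <;> simp <;> omega
  · have key : ∀ b, (Finsupp.single a i : Idx) ≠ Finsupp.single b (2 * t) := by
      intro b h
      have := DFunLike.congr_fun h b
      rw [Finsupp.single_eq_same, Finsupp.single_apply] at this
      split_ifs at this <;> omega
    simp only [Nat.add_sub_cancel, Set.mem_insert_iff, Set.mem_singleton_iff, not_or]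
    exact ⟨key 0, key 1⟩

end BMS

theorem mainTheorem3 {F L : Type*} [Field F] [Finite F] [Field L] [Algebra F L]
    (r : Fin 2 → ℕ) (hq : Nat.Coprime (Nat.card F) (r 0 * r 1))
    (α : Fin 2 → L) (hα : ∀ i, IsPrimitiveRoot (α i) (r i))
    (t : ℕ) (ht2 : 2 ≤ t) (ht4 : t ≤ 4) (htr : ∀ i, t ≤ r i / 2)
    (τ : BMS.Idx) (hτ : τ ∈ BMS.indexSet r)
    (e : MvPolynomial (Fin 2) F) (he : ∀ m ∈ e.support, m ∈ BMS.indexSet r)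
    (hw : e.support.card ≤ t)
    (T : MonomialOrder (Fin 2)) (hT : T = MonomialOrder.lex ∨ T = BMS.gradedOrder)
    (K : Set BMS.Idx) (hK : BMS.hyperbolicSet r (2 * t + 1) ⊆ K)
    (l : BMS.Idx) (hlF : l ∈ BMS.borderSet r t)
    (hl : l = Finsupp.single 0 (2 * t - 1) ∨ l = Finsupp.single 1 (2 * t - 1))
    (d : ℕ) (f : Fin d → MvPolynomial (Fin 2) L)
    (hf : BMS.IsMinimalSet T K (BMS.syndromeTable α τ e) l f) :
    (¬ BMS.Exceptional T t l f →
      ∃ i, T.degree (f i) ≤ l ∧ BMS.recVal T (BMS.syndromeTable α τ e) (f i) l = 0) ∧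
    (BMS.Exceptional T t l f → d = 2) := by
  have hU := BMS.syndromeTable_eq_sum α τ e
  have hKa : ∀ a, ∀ i < 2 * t - 1, Finsupp.single a i ∈ K := fun a i hi =>
    hK (BMS.single_mem_hyperbolicSet htr a (by omega))
  have hpos := hf.pos
  have hfst : T.degree (f ⟨0, hf.pos⟩) 0 ≤ t := by
    have := hf.card_le hU _ hf.axis_fst_subset
    rw [BMS.card_axis] at this
    exact this.trans hw
  have hsnd : T.degree (f ⟨d - 1, Nat.sub_lt hf.pos one_pos⟩) 1 ≤ t := by
    have := hf.card_le hU _ hf.axis_snd_subset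
    rw [BMS.card_axis] at this
    exact this.trans hw
  have hfst3 : 2 < d → T.degree (f ⟨0, hf.pos⟩) 0 < t := fun hd =>
    (hf.card_axis_le hU zero_ne_one hf.axis_fst_subset (hf.single_one_mem hd 1)).trans hw
  have hsnd3 : 2 < d → T.degree (f ⟨d - 1, Nat.sub_lt hf.pos one_pos⟩) 1 < t := fun hd =>
    (hf.card_axis_le hU one_ne_zero hf.axis_snd_subset (hf.single_one_mem hd 0)).trans hw
  constructor
  · intro hex
    rcases hl with rfl | rfl
    · refine ⟨⟨0, hf.pos⟩, BMS.Generates.recVal_single_eq_zero hU hw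
        (s := T.degree (f ⟨0, hf.pos⟩) 0) ?_ ?_ (hKa 0) (hf.generates _)⟩
      · ext b
        fin_cases b
        · simp
        · simpa using hf.first_snd
      · exact lt_of_le_of_ne hfst fun h => hex (Or.inr ⟨rfl, _, rfl, h⟩)
    · refine ⟨⟨d - 1, Nat.sub_lt hf.pos one_pos⟩, BMS.Generates.recVal_single_eq_zero hU hw
        (s := T.degree (f ⟨d - 1, Nat.sub_lt hf.pos one_pos⟩) 1) ?_ ?_ (hKa 1)
        (hf.generates _)⟩
      · ext b
        fin_cases b
        · simpa using hf.last_fst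
        · simp
      · refine lt_of_le_of_ne hsnd fun h => hex (Or.inl ⟨rfl, _, ?_, h⟩)
        -- The exception concerns the second polynomial, the bound the last one; `s = t` forces `d =
        -- 2`, where they coincide.
        have h2 : ¬ 2 < d := fun hd => (hsnd3 hd).ne h
        have h1 : d ≠ 1 := by
          rintro rfl
          have := hf.first_snd
          simp only [Nat.sub_self] at h
          omega
        simp only
        omega
  · rintro (⟨-, i, hi, hit⟩ | ⟨-, i, hi, hit⟩)
    · have h2 : ¬ 2 < d := fun hd => by
        have h12 : T.degree (f i) 1 ≤ T.degree (f ⟨d - 1, Nat.sub_lt hf.pos one_pos⟩) 1 :=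
          hf.strictMono_snd.monotone (Fin.le_def.2 (by simp only; omega))
        have := hsnd3 hd
        omega
      have := i.2
      omega
    · obtain rfl : i = ⟨0, hf.pos⟩ := Fin.ext hi
      have h2 : ¬ 2 < d := fun hd => (hfst3 hd).ne hit
      have h1 : d ≠ 1 := by
        rintro rfl
        have := hf.last_fst
        simp only [Nat.sub_self] at this
        omega
      omega
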